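/- Let $\mathcal X$ and $\mathcal A$ be (strict) 2-categories with small hom-categories, and let $G:\mathcal A\to\mathcal X$ be a pseudo functor, with invertible coherence 2-cells $\gamma^G_{f,g}:Gg\circ Gf\Rightarrow G(g\circ f)$ and $\delta^G_A:1_{GA}\Rightarrow G1_A$. Write $\mathrm{Mor}(-,-)$ for hom-categories, $\odot$ and $*$ for vertical and horizontal composition of 2-cells, and $i_f$ for the identity 2-cell of $f$. All coherence 2-cells of pseudo functors and pseudo natural transformations are invertible and satisfy the usual unit and composition axioms. *Definitions.* For $X\in\mathcal X$, $R\in\mathcal A$, an arrow $u:X\to GR$ is *biuniversal from $X$ to $G$* if for every $A\in\mathcal A$ the functor $$\mathrm{Mor}_{\mathcal A}(R,A)\to\mathrm{Mor}_{\mathcal X}(X,GA),\qquad f\mapsto Gf\circ u,\quad \gamma\mapsto G\gamma * i_u,$$ is an equivalence of categories. A *biadjunction* $\langle F,G,\phi\rangle:\mathcal X\rightharpoonup\mathcal A$ consists of pseudo functors $F:\mathcal X\to\mathcal A$ and $G:\mathcal A\to\mathcal X$ and equivalences of categories $\phi_{X,A}:\mathrm{Mor}_{\mathcal A}(FX,A)\to\mathrm{Mor}_{\mathcal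 X}(X,GA)$, together with coherence 2-cells that make $\phi$ pseudo natural in each variable: $\phi_{-,A}:\mathrm{Mor}_{\mathcal A}(F-,A)\Rightarrow\mathrm{Mor}_{\mathcal X}(-,GA)$ for each $A$, and $\phi_{X,-}:\mathrm{Mor}_{\mathcal A}(FX,-)\Rightarrow\mathrm{Mor}_{\mathcal X}(X,G-)$ for each $X$. Then $F$ is called a *left biadjoint* for $G$. *Theorem.* (1) There exists a left biadjoint for $G$ if and only if for every object $X$ of $\mathcal X$ there exist an object $R$ of $\mathcal A$ and a biuniversal arrow $X\to GR$ from $X$ to $G$. (2) Suppose that for every $X\in\mathcal X$ an object $R_X$ of $\mathcal A$ and a biuniversal arrow $\eta_X:X\to GR_X$ are chosen. Then there is a pseudo functor $F:\mathcal X\to\mathcal A$ with $FX=R_X$ for all $X$, and there are invertible 2-cells $\tau_f:GFf\circ\eta_X\Rightarrow\eta_Y\circ f$ for $f:X\to Y$, which make $\eta:1_{\mathcal X}\Rightarrow GF$ a pseudo natural transformation, such that $F$ is a left biadjoint for $G$ by a biadjunction $\langle F,G,\phi\rangle$ with $\phi_{X,A}(f)=Gf\circ\eta_X$ and $\phi_{X,A}(\gamma)=G\gamma*i_{\eta_X}$,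 whose coherence 2-cells have the components $$\gamma^G_{e,k}*i_{\eta_X}:\ Gk\circ Ge\circ\eta_X\Rightarrow G(k\circ e)\circ\eta_X\qquad(e:FX\to A,\ k:A\to A')$$ for $\phi_{X,-}$, and $$(\gamma^G_{Ff,h}*i_{\eta_X})\odot(i_{Gh}*\tau_f^{-1}):\ Gh\circ\eta_Y\circ f\Rightarrow G(h\circ Ff)\circ\eta_X\qquad(f:X\to Y,\ h:FY\to A)$$ for $\phi_{-,A}$. -/

import Mathlib

open CategoryTheory Bicategory Opposite
open Bicategory.Opposite (op2)

universe w v w₁ w₂ v₁ v₂ u₁ u₂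

namespace Biadj

/-- The opposite pseudofunctor `Bᵒᵖ ⥤ᵖ Cᵒᵖ` of a pseudofunctor (only 1-cells are reversed). -/
def opPseudofunctor {B : Type u₁} [Bicategory.{w₁, v₁} B] {C : Type u₂} [Bicategory.{w₂, v₂} C]
    (F : B ⥤ᵖ C) : Bᵒᵖ ⥤ᵖ Cᵒᵖ where
  obj X := op (F.obj X.unop)
  map f := (F.map f.unop).op
  map₂ α := op2 (F.map₂ α.unop2)
  map₂_id f := congrArg op2 (F.map₂_id f.unop)
  map₂_comp α β := congrArg op2 (F.map₂_comp α.unop2 β.unop2)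
  mapId X := (F.mapId X.unop).op2
  mapComp f g := (F.mapComp g.unop f.unop).op2
  map₂_whisker_left f _ _ α := congrArg op2 (F.map₂_whisker_right α.unop2 f.unop)
  map₂_whisker_right α h := congrArg op2 (F.map₂_whisker_left h.unop α.unop2)
  map₂_associator f g h := congrArg op2 (by
    change F.map₂ (α_ h.unop g.unop f.unop).inv =
      (F.mapComp h.unop (g.unop ≫ f.unop)).hom ≫
        F.map h.unop ◁ (F.mapComp g.unop f.unop).hom ≫
          (α_ (F.map h.unop) (F.map g.unop) (F.map f.unop)).inv ≫
            (F.mapComp h.unop g.unop).inv ▷ F.map f.unop ≫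
              (F.mapComp (h.unop ≫ g.unop) f.unop).inv
    rw [F.mapComp_assoc_right_hom_assoc]
    simp)
  map₂_left_unitor f := congrArg op2 (F.map₂_right_unitor f.unop)
  map₂_right_unitor f := congrArg op2 (F.map₂_left_unitor f.unop)

/-- The hom pseudofunctor `Mor(X, -) : B ⥤ᵖ Cat`, acting on 1- and 2-cells by postcomposition.
The hom pseudofunctor `Mor(-, X) : Bᵒᵖ ⥤ᵖ Cat` is Mathlib's `Bicategory.yoneda₀ X`. -/
def coyoneda₀ {B : Type u₁} [Bicategory.{w, v} B] (X : B) : B ⥤ᵖ Cat.{w, v} where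
  toPrelaxFunctor :=
    PrelaxFunctor.mkOfHomFunctors (fun Y => Cat.of (X ⟶ Y)) (fun Y Z => postcomposingCat X Y Z)
  mapId Y := rightUnitorNatIsoCat X Y
  mapComp f g := (associatorNatIsoLeftCat X f g).symm
  map₂_whisker_left {Y _ _} f g h η := by
    have key : ∀ x : X ⟶ Y, x ◁ (f ◁ η) = (α_ x f g).inv ≫ (x ≫ f) ◁ η ≫ (α_ x f h).hom := by
      intro x; simp
    ext x
    exact key x
  map₂_whisker_right {Y _ _ f g} η h := by
    have key : ∀ x : X ⟶ Y, x ◁ (η ▷ h) = (α_ x f h).inv ≫ (x ◁ η) ▷ h ≫ (α_ x g h).hom := by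
      intro x; simp
    ext x
    exact key x
  map₂_associator {Y _ _ _} f g h := by
    have key : ∀ x : X ⟶ Y, x ◁ (α_ f g h).hom = (α_ x (f ≫ g) h).inv ≫ (α_ x f g).inv ▷ h ≫
        𝟙 _ ≫ (α_ (x ≫ f) g h).hom ≫ (α_ x f (g ≫ h)).hom := by
      intro x; simp
    ext x
    exact key x
  map₂_left_unitor {Y _} f := by
    have key : ∀ x : X ⟶ Y, x ◁ (λ_ f).hom = (α_ x (𝟙 Y) f).inv ≫ (ρ_ x).hom ▷ f ≫ 𝟙 _ := by
      intro x; simp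
    ext x
    exact key x
  map₂_right_unitor {Y Z} f := by
    have key : ∀ x : X ⟶ Y, x ◁ (ρ_ f).hom = (α_ x f (𝟙 Z)).inv ≫ (ρ_ (x ≫ f)).hom ≫ 𝟙 _ := by
      intro x; simp
    ext x
    exact key x

/-- The data making a family of 1-cells `app a : F a ⟶ G a` into a pseudo natural transformation
`F ⟹ G` : invertible coherence 2-cells, natural in the 1-cell, satisfying the unit axiom and the
composition axiom. (This is `Pseudofunctor.StrongTrans` with prescribed components, see
`PseudoNaturality.toStrongTrans` and `PseudoNaturality.ofStrongTrans`.) -/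
structure PseudoNaturality {B : Type u₁} [Bicategory.{w₁, v₁} B]
    {C : Type u₂} [Bicategory.{w₂, v₂} C] (F G : B ⥤ᵖ C)
    (app : ∀ a : B, F.obj a ⟶ G.obj a) where
  naturality {a b : B} (f : a ⟶ b) : F.map f ≫ app b ≅ app a ≫ G.map f
  naturality_naturality {a b : B} {f g : a ⟶ b} (η : f ⟶ g) :
    F.map₂ η ▷ app b ≫ (naturality g).hom = (naturality f).hom ≫ app a ◁ G.map₂ η
  naturality_id (a : B) :
    (naturality (𝟙 a)).hom ≫ app a ◁ (G.mapId a).hom =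
      (F.mapId a).hom ▷ app a ≫ (λ_ (app a)).hom ≫ (ρ_ (app a)).inv
  naturality_comp {a b c : B} (f : a ⟶ b) (g : b ⟶ c) :
    (naturality (f ≫ g)).hom ≫ app a ◁ (G.mapComp f g).hom =
      (F.mapComp f g).hom ▷ app c ≫ (α_ _ _ _).hom ≫ F.map f ◁ (naturality g).hom ≫
        (α_ _ _ _).inv ≫ (naturality f).hom ▷ G.map g ≫ (α_ _ _ _).hom

/-- A family of 1-cells with pseudo naturality data is a pseudo natural transformation. -/
def PseudoNaturality.toStrongTrans {B : Type u₁} [Bicategory.{w₁, v₁} B]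
    {C : Type u₂} [Bicategory.{w₂, v₂} C] {F G : B ⥤ᵖ C}
    {app : ∀ a : B, F.obj a ⟶ G.obj a} (t : PseudoNaturality F G app) :
    Pseudofunctor.StrongTrans F G where
  app := app
  naturality := t.naturality
  naturality_naturality := t.naturality_naturality
  naturality_id := t.naturality_id
  naturality_comp := t.naturality_comp

/-- The components of a pseudo natural transformation carry pseudo naturality data. -/
def PseudoNaturality.ofStrongTrans {B : Type u₁} [Bicategory.{w₁, v₁} B]
    {C : Type u₂} [Bicategory.{w₂, v₂} C] {F G : B ⥤ᵖ C}
    (t : Pseudofunctor.StrongTrans F G) : PseudoNaturality F G t.app where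
  naturality := t.naturality
  naturality_naturality := t.naturality_naturality
  naturality_id := t.naturality_id
  naturality_comp := t.naturality_comp

/-- For `u : X ⟶ G R`, the functor `Mor(R, A) ⥤ Mor(X, G A)` given by `f ↦ G f ∘ u` on 1-cells
and `γ ↦ G γ * i_u` on 2-cells. (Mathlib writes composites in diagrammatic order.) -/
def arrowFunctor {𝒳 : Type u₁} [Bicategory.{w₁, v₁} 𝒳] {𝒜 : Type u₂} [Bicategory.{w₂, v₂} 𝒜]
    (G : 𝒜 ⥤ᵖ 𝒳) {X : 𝒳} {R : 𝒜} (u : X ⟶ G.obj R) (A : 𝒜) : (R ⟶ A) ⥤ (X ⟶ G.obj A) where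
  obj f := u ≫ G.map f
  map γ := u ◁ G.map₂ γ
  map_id f := by rw [G.map₂_id, Bicategory.whiskerLeft_id]
  map_comp γ δ := by rw [G.map₂_comp, Bicategory.whiskerLeft_comp]

/-- `u : X ⟶ G R` is a biuniversal arrow from `X` to `G`. -/
def IsBiuniversal {𝒳 : Type u₁} [Bicategory.{w₁, v₁} 𝒳] {𝒜 : Type u₂} [Bicategory.{w₂, v₂} 𝒜]
    (G : 𝒜 ⥤ᵖ 𝒳) {X : 𝒳} {R : 𝒜} (u : X ⟶ G.obj R) : Prop :=
  ∀ A : 𝒜, (arrowFunctor G u A).IsEquivalence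

/-- The remaining data and conditions that make `⟨F, G, φ⟩ : 𝒳 ⇀ 𝒜` a biadjunction: every
`φ X A : Mor(F X, A) ⥤ Mor(X, G A)` is an equivalence of categories, and `φ` is equipped with
coherence 2-cells making it pseudo natural in each variable. -/
structure Biadjunction {𝒳 : Type u₁} [Bicategory.{w, v} 𝒳] {𝒜 : Type u₂} [Bicategory.{w, v} 𝒜]
    (F : 𝒳 ⥤ᵖ 𝒜) (G : 𝒜 ⥤ᵖ 𝒳)
    (φ : ∀ (X : 𝒳) (A : 𝒜), (F.obj X ⟶ A) ⥤ (X ⟶ G.obj A)) where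
  isEquivalence (X : 𝒳) (A : 𝒜) : (φ X A).IsEquivalence
  /-- For fixed `A`, pseudo naturality of `φ` as a map `Mor(F -, A) ⟹ Mor(-, G A)`. -/
  natLeft (A : 𝒜) :
    PseudoNaturality ((opPseudofunctor F).comp (yoneda₀ A)) (yoneda₀ (G.obj A))
      (fun X => (φ X.unop A).toCatHom)
  /-- For fixed `X`, pseudo naturality of `φ` as a map `Mor(F X, -) ⟹ Mor(X, G -)`. -/
  natRight (X : 𝒳) :
    PseudoNaturality (coyoneda₀ (F.obj X)) (G.comp (coyoneda₀ X))
      (fun A => (φ X A).toCatHom)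

/-- `F` is a left biadjoint for `G`. -/
def IsLeftBiadjoint {𝒳 : Type u₁} [Bicategory.{w, v} 𝒳] {𝒜 : Type u₂} [Bicategory.{w, v} 𝒜]
    (F : 𝒳 ⥤ᵖ 𝒜) (G : 𝒜 ⥤ᵖ 𝒳) : Prop :=
  ∃ φ : ∀ (X : 𝒳) (A : 𝒜), (F.obj X ⟶ A) ⥤ (X ⟶ G.obj A), Nonempty (Biadjunction F G φ)

end Biadj

/-!
A left biadjoint is the same thing as a choice of biuniversal arrows, and both directions are a
bicategorical form of the Yoneda argument.

Given a biadjunction `⟨F, G, φ⟩`, the arrow `φ (𝟙 (F X)) : X ⟶ G (F X)` is biuniversal: pseudo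
naturality of `φ X -` at `f : F X ⟶ A`, evaluated at `𝟙 (F X)`, gives an isomorphism
`φ f ≅ φ (𝟙 (F X)) ≫ G f`, natural in `f`. So the functor `arrowFunctor` of this arrow is isomorphic
to the equivalence `φ X A` (`Biadjunction.isBiuniversal`).

Conversely, let `u X : X ⟶ G (r X)` be biuniversal for every `X`. Essential surjectivity of
`arrowFunctor` provides, for `f : X ⟶ Y`, a 1-cell `liftMap f : r X ⟶ r Y` and an invertible 2-cell
`unitIso f : f ≫ u Y ≅ u X ≫ G (liftMap f)`. Full faithfulness says that `a ↦ u X ◁ G a` is a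
bijection from the 2-cells `k ⟶ l` to the 2-cells `u X ≫ G k ⟶ u X ≫ G l`. The action of `F` on
2-cells and its coherence 2-cells are therefore determined by requiring the naturality, unit and
composition axioms that make the `unitIso f` pseudo natural; these are `unitIso_naturality`,
`unitIso_id` and `unitIso_comp`. Every pseudofunctor axiom for `F` is an equation between 2-cells
out of some `liftMap f`, so it may be checked after applying `unitIso f ≫ u X ◁ G -`
(`liftMap_hom_ext`). There the three axioms reduce it to interchange and to the coherence of `G`.

The functors `f ↦ u X ≫ G f` are equivalences by assumption. Their pseudo naturality in `A` is the
coherence of `G` (`arrowNatRight`); in `X` it combines the coherence of `G` with the inverse of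
`unitIso` (`precompIso` and `arrowNatLeft`).
-/

namespace Biadj

/-! ### Factoring cells through a biuniversal arrow -/

section Lift

variable {𝒳 : Type u₁} [Bicategory.{w₁, v₁} 𝒳] {𝒜 : Type u₂} [Bicategory.{w₂, v₂} 𝒜]
  {G : 𝒜 ⥤ᵖ 𝒳} {X : 𝒳} {R : 𝒜} {u : X ⟶ G.obj R}

namespace IsBiuniversal

/-- Faithfulness of `arrowFunctor G u A`. -/
theorem hom_ext (hu : IsBiuniversal G u) {A : 𝒜} {f g : R ⟶ A} {a b : f ⟶ g}
    (h : u ◁ G.map₂ a = u ◁ G.map₂ b) : a = b :=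
  haveI := hu A
  (arrowFunctor G u A).map_injective h

/-- A 1-cell `R ⟶ A` representing `v : X ⟶ G A` along the biuniversal arrow `u : X ⟶ G R`. -/
noncomputable def lift (hu : IsBiuniversal G u) {A : 𝒜} (v : X ⟶ G.obj A) : R ⟶ A :=
  haveI := hu A
  (arrowFunctor G u A).objPreimage v

/-- The invertible 2-cell exhibiting `hu.lift v` as a factorization of `v` through `u`. -/
noncomputable def liftIso (hu : IsBiuniversal G u) {A : 𝒜} (v : X ⟶ G.obj A) :
    v ≅ u ≫ G.map (hu.lift v) :=
  haveI := hu A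
  ((arrowFunctor G u A).objObjPreimageIso v).symm

/-- The unique 2-cell `a` with `u ◁ G.map₂ a = β`. -/
noncomputable def lift₂ (hu : IsBiuniversal G u) {A : 𝒜} {f g : R ⟶ A}
    (β : u ≫ G.map f ⟶ u ≫ G.map g) : f ⟶ g :=
  haveI := hu A
  (arrowFunctor G u A).preimage β

@[simp]
theorem whiskerLeft_map₂_lift₂ (hu : IsBiuniversal G u) {A : 𝒜} {f g : R ⟶ A}
    (β : u ≫ G.map f ⟶ u ≫ G.map g) : u ◁ G.map₂ (hu.lift₂ β) = β :=
  haveI := hu A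
  (arrowFunctor G u A).map_preimage β

/-- The invertible version of `lift₂`. -/
@[simps]
noncomputable def liftIso₂ (hu : IsBiuniversal G u) {A : 𝒜} {f g : R ⟶ A}
    (β : u ≫ G.map f ≅ u ≫ G.map g) : f ≅ g where
  hom := hu.lift₂ β.hom
  inv := hu.lift₂ β.inv
  hom_inv_id := hu.hom_ext (by simp)
  inv_hom_id := hu.hom_ext (by simp)

end IsBiuniversal

end Lift

/-! ### The cells of the left biadjoint -/

section Construction

variable {𝒳 : Type u₁} [Bicategory.{w₁, v₁} 𝒳] {𝒜 : Type u₂} [Bicategory.{w₂, v₂} 𝒜]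
  {G : 𝒜 ⥤ᵖ 𝒳} {r : 𝒳 → 𝒜} {u : ∀ X : 𝒳, X ⟶ G.obj (r X)}
  (hu : ∀ X : 𝒳, IsBiuniversal G (u X))

/-- The left biadjoint on 1-cells: the chosen lift of `f ≫ u Y` along `u X`. -/
noncomputable def liftMap {X Y : 𝒳} (f : X ⟶ Y) : r X ⟶ r Y := (hu X).lift (f ≫ u Y)

/-- The pseudo naturality 2-cell of the unit at `f`. -/
noncomputable def unitIso {X Y : 𝒳} (f : X ⟶ Y) : f ≫ u Y ≅ u X ≫ G.map (liftMap hu f) :=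
  (hu X).liftIso (f ≫ u Y)

/-- The left biadjoint on 2-cells, determined by `unitIso_naturality`. -/
noncomputable def liftMap₂ {X Y : 𝒳} {f g : X ⟶ Y} (β : f ⟶ g) : liftMap hu f ⟶ liftMap hu g :=
  (hu X).lift₂ ((unitIso hu f).inv ≫ β ▷ u Y ≫ (unitIso hu g).hom)

/-- The unit coherence 2-cell of the left biadjoint, determined by `unitIso_id`. -/
noncomputable def liftMapId (X : 𝒳) : liftMap hu (𝟙 X) ≅ 𝟙 (r X) :=
  (hu X).liftIso₂ ((unitIso hu (𝟙 X)).symm ≪≫ λ_ (u X) ≪≫ (ρ_ (u X)).symm ≪≫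
    whiskerLeftIso (u X) (G.mapId (r X)).symm)

/-- The composition coherence 2-cell of the left biadjoint, determined by `unitIso_comp`. -/
noncomputable def liftMapComp {X Y Z : 𝒳} (f : X ⟶ Y) (g : Y ⟶ Z) :
    liftMap hu (f ≫ g) ≅ liftMap hu f ≫ liftMap hu g :=
  (hu X).liftIso₂ ((unitIso hu (f ≫ g)).symm ≪≫ α_ f g (u Z) ≪≫
    whiskerLeftIso f (unitIso hu g) ≪≫ (α_ f (u Y) (G.map (liftMap hu g))).symm ≪≫
    whiskerRightIso (unitIso hu f) (G.map (liftMap hu g)) ≪≫ α_ (u X) _ _ ≪≫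
    whiskerLeftIso (u X) (G.mapComp (liftMap hu f) (liftMap hu g)).symm)

theorem unitIso_naturality {X Y : 𝒳} {f g : X ⟶ Y} (β : f ⟶ g) :
    (unitIso hu f).hom ≫ u X ◁ G.map₂ (liftMap₂ hu β) = β ▷ u Y ≫ (unitIso hu g).hom := by
  simp [liftMap₂]

theorem unitIso_id (X : 𝒳) :
    (unitIso hu (𝟙 X)).hom ≫ u X ◁ G.map₂ (liftMapId hu X).hom =
      (λ_ (u X)).hom ≫ (ρ_ (u X)).inv ≫ u X ◁ (G.mapId (r X)).inv := by
  simp [liftMapId]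

theorem unitIso_comp {X Y Z : 𝒳} (f : X ⟶ Y) (g : Y ⟶ Z) :
    (unitIso hu (f ≫ g)).hom ≫ u X ◁ G.map₂ (liftMapComp hu f g).hom =
      (α_ f g (u Z)).hom ≫ f ◁ (unitIso hu g).hom ≫ (α_ f (u Y) (G.map (liftMap hu g))).inv ≫
        (unitIso hu f).hom ▷ G.map (liftMap hu g) ≫ (α_ (u X) _ _).hom ≫
          u X ◁ (G.mapComp (liftMap hu f) (liftMap hu g)).inv := by
  simp [liftMapComp]

/-- Two 2-cells out of `liftMap f` agree as soon as they agree after pasting with `unitIso f`. The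
axioms of the left biadjoint are proved by this principle. -/
theorem liftMap_hom_ext {X Y : 𝒳} {f : X ⟶ Y} {k : r X ⟶ r Y} {a b : liftMap hu f ⟶ k}
    (h : (unitIso hu f).hom ≫ u X ◁ G.map₂ a = (unitIso hu f).hom ≫ u X ◁ G.map₂ b) : a = b :=
  (hu X).hom_ext ((cancel_epi _).1 h)

/-- The interchange law for a 2-cell between composites, with the associators made explicit. -/
theorem whiskerRight_assoc_whiskerLeft {a b c d e : 𝒳} {p : a ⟶ b} {q : b ⟶ d} {s : a ⟶ c}
    {t : c ⟶ d} (θ : p ≫ q ⟶ s ≫ t) {k l : d ⟶ e} (β : k ⟶ l) :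
    θ ▷ k ≫ (α_ s t k).hom ≫ s ◁ t ◁ β =
      (α_ p q k).hom ≫ p ◁ q ◁ β ≫ (α_ p q l).inv ≫ θ ▷ l ≫ (α_ s t l).hom := by
  have := whisker_exchange θ β
  simp only [comp_whiskerLeft, Category.assoc] at this
  simpa using (this =≫ (α_ s t l).hom).symm

theorem whiskerRight_assoc_whiskerLeft_whiskerRight {a b c d : 𝒳} {p : a ⟶ c} {s : a ⟶ b}
    {t t' : b ⟶ c} (θ : p ⟶ s ≫ t) (β : t ⟶ t') (k : c ⟶ d) :
    θ ▷ k ≫ (α_ s t k).hom ≫ s ◁ β ▷ k = (θ ≫ s ◁ β) ▷ k ≫ (α_ s t' k).hom := by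
  simp

/-- Naturality of `liftMapComp` in the second 1-cell. The inverse coherence cell in the
pseudofunctor axiom is moved to the other side, so that both sides start at a `liftMap`. -/
theorem liftMap₂_whiskerLeft {X Y Z : 𝒳} (f : X ⟶ Y) {g h : Y ⟶ Z} (β : g ⟶ h) :
    liftMap₂ hu (f ◁ β) ≫ (liftMapComp hu f h).hom =
      (liftMapComp hu f g).hom ≫ liftMap hu f ◁ liftMap₂ hu β := by
  apply liftMap_hom_ext
  simp only [G.map₂_comp, Bicategory.whiskerLeft_comp, reassoc_of% unitIso_naturality hu,
    unitIso_comp, reassoc_of% unitIso_comp hu, G.map₂_whisker_left, whiskerLeft_inv_hom_assoc,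
    reassoc_of% whiskerRight_assoc_whiskerLeft]
  simp only [Iso.inv_hom_id_assoc, ← whiskerLeft_comp_assoc, unitIso_naturality]
  simp

theorem liftMap₂_whiskerRight {X Y Z : 𝒳} {f g : X ⟶ Y} (β : f ⟶ g) (h : Y ⟶ Z) :
    liftMap₂ hu (β ▷ h) ≫ (liftMapComp hu g h).hom =
      (liftMapComp hu f h).hom ≫ liftMap₂ hu β ▷ liftMap hu h := by
  apply liftMap_hom_ext
  simp only [G.map₂_comp, Bicategory.whiskerLeft_comp, reassoc_of% unitIso_naturality hu,
    unitIso_comp, reassoc_of% unitIso_comp hu, G.map₂_whisker_right, whiskerLeft_inv_hom_assoc,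
    reassoc_of% whiskerRight_assoc_whiskerLeft_whiskerRight (unitIso hu _).hom, unitIso_naturality]
  simp only [comp_whiskerRight, Category.assoc]
  rw [associator_naturality_left_assoc, ← whisker_exchange_assoc,
    associator_inv_naturality_left_assoc]

theorem liftMap₂_associator {W X Y Z : 𝒳} (f : W ⟶ X) (g : X ⟶ Y) (h : Y ⟶ Z) :
    liftMap₂ hu (α_ f g h).hom ≫ (liftMapComp hu f (g ≫ h)).hom ≫
        liftMap hu f ◁ (liftMapComp hu g h).hom =
      (liftMapComp hu (f ≫ g) h).hom ≫ (liftMapComp hu f g).hom ▷ liftMap hu h ≫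
        (α_ _ _ _).hom := by
  apply liftMap_hom_ext
  simp only [Category.assoc, G.map₂_comp, Bicategory.whiskerLeft_comp,
    reassoc_of% unitIso_naturality hu, unitIso_comp, reassoc_of% unitIso_comp hu,
    G.map₂_whisker_left, G.map₂_whisker_right, whiskerLeft_inv_hom_assoc,
    reassoc_of% whiskerRight_assoc_whiskerLeft,
    reassoc_of% whiskerRight_assoc_whiskerLeft_whiskerRight (unitIso hu _).hom,
    G.map₂_associator]
  simp only [Iso.inv_hom_id_assoc, ← whiskerLeft_comp_assoc, unitIso_comp]
  simp only [comp_whiskerRight, Category.assoc, Bicategory.whiskerLeft_comp]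
  simp
  -- What is left is to slide `G.mapComp` of `g` and `h` past `unitIso f`.
  rw [associator_naturality_left_assoc, reassoc_of% whiskerRight_assoc_whiskerLeft]
  simp

theorem liftMap₂_leftUnitor {X Y : 𝒳} (f : X ⟶ Y) :
    liftMap₂ hu (λ_ f).hom =
      (liftMapComp hu (𝟙 X) f).hom ≫ (liftMapId hu X).hom ▷ liftMap hu f ≫ (λ_ _).hom := by
  apply liftMap_hom_ext
  simp only [Category.assoc, G.map₂_comp, Bicategory.whiskerLeft_comp, unitIso_naturality,
    reassoc_of% unitIso_comp hu, G.map₂_whisker_right, whiskerLeft_inv_hom_assoc,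
    reassoc_of% whiskerRight_assoc_whiskerLeft_whiskerRight (unitIso hu _).hom,
    G.map₂_left_unitor, unitIso_id]
  simp

theorem liftMap₂_rightUnitor {X Y : 𝒳} (f : X ⟶ Y) :
    liftMap₂ hu (ρ_ f).hom =
      (liftMapComp hu f (𝟙 Y)).hom ≫ liftMap hu f ◁ (liftMapId hu Y).hom ≫ (ρ_ _).hom := by
  apply liftMap_hom_ext
  simp only [Category.assoc, G.map₂_comp, Bicategory.whiskerLeft_comp, unitIso_naturality,
    reassoc_of% unitIso_comp hu, G.map₂_whisker_left, whiskerLeft_inv_hom_assoc,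
    reassoc_of% whiskerRight_assoc_whiskerLeft, G.map₂_right_unitor]
  rw [Iso.inv_hom_id_assoc, ← whiskerLeft_comp_assoc f, unitIso_id]
  simp

end Construction

/-! ### The left biadjoint and its unit -/

section LeftBiadjoint

variable {𝒳 : Type u₁} [Bicategory.{w₁, v₁} 𝒳] {𝒜 : Type u₂} [Bicategory.{w₂, v₂} 𝒜]
  {G : 𝒜 ⥤ᵖ 𝒳} {r : 𝒳 → 𝒜} {u : ∀ X : 𝒳, X ⟶ G.obj (r X)}
  (hu : ∀ X : 𝒳, IsBiuniversal G (u X))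

/-- The left biadjoint of `G` determined by biuniversal arrows `u X : X ⟶ G (r X)`. It sends `X` to
`r X`, on the nose. -/
noncomputable def leftBiadjoint : 𝒳 ⥤ᵖ 𝒜 where
  obj := r
  map f := liftMap hu f
  map₂ β := liftMap₂ hu β
  map₂_id f := liftMap_hom_ext hu (by rw [unitIso_naturality]; simp)
  map₂_comp β γ := liftMap_hom_ext hu (by
    rw [unitIso_naturality, G.map₂_comp, Bicategory.whiskerLeft_comp,
      reassoc_of% unitIso_naturality hu, unitIso_naturality]
    simp)
  mapId := liftMapId hu
  mapComp := liftMapComp hu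
  map₂_whisker_left f _ _ β := by simp [← reassoc_of% liftMap₂_whiskerLeft]
  map₂_whisker_right β h := by simp [← reassoc_of% liftMap₂_whiskerRight]
  map₂_associator f g h := by simp [← reassoc_of% liftMap₂_associator]
  map₂_left_unitor f := liftMap₂_leftUnitor hu f
  map₂_right_unitor f := liftMap₂_rightUnitor hu f

/-- The unit of the biadjunction: the biuniversal arrows as a pseudo natural transformation. -/
noncomputable def unit :
    Pseudofunctor.StrongTrans (Pseudofunctor.id 𝒳) ((leftBiadjoint hu).comp G) where
  app := u
  naturality f := unitIso hu f
  naturality_naturality β := (unitIso_naturality hu β).symm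
  naturality_id X := by
    have h := unitIso_id hu X
    change (unitIso hu (𝟙 X)).hom ≫ u X ◁ (G.map₂ (liftMapId hu X).hom ≫ (G.mapId _).hom) =
      𝟙 _ ▷ u X ≫ (λ_ (u X)).hom ≫ (ρ_ (u X)).inv
    rw [Bicategory.whiskerLeft_comp, reassoc_of% h]
    simp
  naturality_comp {X Y Z} f g := by
    have h := unitIso_comp hu f g
    change (unitIso hu (f ≫ g)).hom ≫
        u X ◁ (G.map₂ (liftMapComp hu f g).hom ≫ (G.mapComp _ _).hom) =
      𝟙 (f ≫ g) ▷ u Z ≫ (α_ f g (u Z)).hom ≫ f ◁ (unitIso hu g).hom ≫ (α_ f (u Y) _).inv ≫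
        (unitIso hu f).hom ▷ G.map (liftMap hu g) ≫ (α_ (u X) _ _).hom
    rw [Bicategory.whiskerLeft_comp, reassoc_of% h]
    simp

end LeftBiadjoint

/-! ### Pseudo naturality of the hom equivalences -/

section PseudoNaturality

variable {𝒳 : Type u₁} [Bicategory.{w, v} 𝒳] {𝒜 : Type u₂} [Bicategory.{w, v} 𝒜]

/-- The functors `e ↦ u ≫ G e` are pseudo natural in the codomain `A` of `e`, for any 1-cell
`u : X ⟶ G R`; the coherence 2-cells are those of `G`. -/
def arrowNatRight (G : 𝒜 ⥤ᵖ 𝒳) {X : 𝒳} {R : 𝒜} (u : X ⟶ G.obj R) :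
    PseudoNaturality (coyoneda₀ R) (G.comp (coyoneda₀ X))
      (fun A => (arrowFunctor G u A).toCatHom) where
  naturality {A A'} k := Cat.Hom.isoMk
    (F := postcomp R k ⋙ arrowFunctor G u A') (G := arrowFunctor G u A ⋙ postcomp X (G.map k)) <|
    NatIso.ofComponents
      (fun e => whiskerLeftIso u (G.mapComp e k) ≪≫ (α_ u (G.map e) (G.map k)).symm) (by
        intro e e' β
        change u ◁ G.map₂ (β ▷ k) ≫ u ◁ (G.mapComp e' k).hom ≫ (α_ _ _ _).inv =
          (u ◁ (G.mapComp e k).hom ≫ (α_ _ _ _).inv) ≫ (u ◁ G.map₂ β) ▷ G.map k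
        simp)
  naturality_naturality {A A' k k'} β := by
    -- Here and below, `key` is the component at `e` of an equation of 2-cells in `Cat`, with the
    -- structure 2-cells of `Cat`, whose components are identities, written out.
    have key : ∀ e : R ⟶ A, u ◁ G.map₂ (e ◁ β) ≫ u ◁ (G.mapComp e k').hom ≫ (α_ _ _ _).inv =
        (u ◁ (G.mapComp e k).hom ≫ (α_ _ _ _).inv) ≫ (u ≫ G.map e) ◁ G.map₂ β := by
      intro e; simp
    ext e
    exact key e
  naturality_id A := by
    have key : ∀ e : R ⟶ A, (u ◁ (G.mapComp e (𝟙 A)).hom ≫ (α_ _ _ _).inv) ≫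
        (u ≫ G.map e) ◁ (G.mapId A).hom ≫ (ρ_ (u ≫ G.map e)).hom =
        u ◁ G.map₂ (ρ_ e).hom ≫ 𝟙 _ ≫ 𝟙 _ := by
      intro e; simp
    ext e
    exact key e
  naturality_comp {A B C} f g := by
    have key : ∀ e : R ⟶ A, (u ◁ (G.mapComp e (f ≫ g)).hom ≫ (α_ _ _ _).inv) ≫
        (u ≫ G.map e) ◁ (G.mapComp f g).hom ≫ (α_ (u ≫ G.map e) _ _).inv =
        u ◁ G.map₂ (α_ e f g).inv ≫ 𝟙 _ ≫
          (u ◁ (G.mapComp (e ≫ f) g).hom ≫ (α_ _ _ _).inv) ≫ 𝟙 _ ≫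
            (u ◁ (G.mapComp e f).hom ≫ (α_ _ _ _).inv) ▷ G.map g ≫ 𝟙 _ := by
      intro e
      simp only [Category.id_comp, Category.comp_id, comp_whiskerLeft, comp_whiskerRight,
        Category.assoc, Iso.inv_hom_id_assoc]
      rw [← whiskerLeft_comp_assoc u, G.mapComp_assoc_right_hom]
      simp
    ext e
    exact key e

variable {G : 𝒜 ⥤ᵖ 𝒳} {r : 𝒳 → 𝒜} {u : ∀ X : 𝒳, X ⟶ G.obj (r X)}
  (hu : ∀ X : 𝒳, IsBiuniversal G (u X))

theorem unitIso_inv_naturality {X Y : 𝒳} {f g : X ⟶ Y} (β : f ⟶ g) :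
    u X ◁ G.map₂ (liftMap₂ hu β) ≫ (unitIso hu g).inv = (unitIso hu f).inv ≫ β ▷ u Y := by
  rw [Iso.comp_inv_eq, Category.assoc, Iso.eq_inv_comp, unitIso_naturality]

theorem unitIso_inv_id (X : 𝒳) :
    (unitIso hu (𝟙 X)).inv = u X ◁ G.map₂ (liftMapId hu X).hom ≫ u X ◁ (G.mapId (r X)).hom ≫
      (ρ_ (u X)).hom ≫ (λ_ (u X)).inv := by
  rw [← cancel_epi (unitIso hu (𝟙 X)).hom, reassoc_of% unitIso_id hu]
  simp

theorem unitIso_inv_comp {X Y Z : 𝒳} (f : X ⟶ Y) (g : Y ⟶ Z) :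
    (unitIso hu (f ≫ g)).inv = u X ◁ G.map₂ (liftMapComp hu f g).hom ≫
      u X ◁ (G.mapComp (liftMap hu f) (liftMap hu g)).hom ≫ (α_ _ _ _).inv ≫
        (unitIso hu f).inv ▷ G.map (liftMap hu g) ≫ (α_ _ _ _).hom ≫ f ◁ (unitIso hu g).inv ≫
          (α_ f g (u Z)).inv := by
  rw [← cancel_epi (unitIso hu (f ≫ g)).hom, reassoc_of% unitIso_comp hu]
  simp

/-- The coherence 2-cell at `h` expressing that `h ↦ u Y ≫ G h` is pseudo natural along
`f : X ⟶ Y`. -/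
noncomputable def precompIso {X Y : 𝒳} {A : 𝒜} (f : X ⟶ Y) (h : r Y ⟶ A) :
    u X ≫ G.map (liftMap hu f ≫ h) ≅ f ≫ u Y ≫ G.map h :=
  whiskerLeftIso (u X) (G.mapComp (liftMap hu f) h) ≪≫
    (α_ (u X) (G.map (liftMap hu f)) (G.map h)).symm ≪≫
    whiskerRightIso (unitIso hu f).symm (G.map h) ≪≫ α_ f (u Y) (G.map h)

theorem precompIso_naturality_right {X Y : 𝒳} {A : 𝒜} (f : X ⟶ Y) {h h' : r Y ⟶ A}
    (γ : h ⟶ h') :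
    u X ◁ G.map₂ (liftMap hu f ◁ γ) ≫ (precompIso hu f h').hom =
      (precompIso hu f h).hom ≫ f ◁ u Y ◁ G.map₂ γ := by
  simp [precompIso, whiskerRight_assoc_whiskerLeft]

theorem precompIso_naturality_left {X Y : 𝒳} {A : 𝒜} {f g : X ⟶ Y} (β : f ⟶ g)
    (h : r Y ⟶ A) :
    u X ◁ G.map₂ (liftMap₂ hu β ▷ h) ≫ (precompIso hu g h).hom =
      (precompIso hu f h).hom ≫ β ▷ (u Y ≫ G.map h) := by
  have := congrArg (· ▷ G.map h) (unitIso_inv_naturality hu β)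
  simp only [comp_whiskerRight, whisker_assoc, Category.assoc] at this
  simp [precompIso, ← reassoc_of% this]

theorem precompIso_id {X : 𝒳} {A : 𝒜} (h : r X ⟶ A) :
    (precompIso hu (𝟙 X) h).hom ≫ (λ_ (u X ≫ G.map h)).hom =
      u X ◁ G.map₂ ((liftMapId hu X).hom ▷ h ≫ (λ_ h).hom) := by
  simp [precompIso, unitIso_inv_id]

theorem precompIso_comp {X Y Z : 𝒳} {A : 𝒜} (f : X ⟶ Y) (g : Y ⟶ Z) (h : r Z ⟶ A) :
    (precompIso hu (f ≫ g) h).hom ≫ (α_ f g (u Z ≫ G.map h)).hom =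
      u X ◁ G.map₂ ((liftMapComp hu f g).hom ▷ h ≫ (α_ _ _ _).hom) ≫
        (precompIso hu f (liftMap hu g ≫ h)).hom ≫ f ◁ (precompIso hu g h).hom := by
  simp [precompIso, unitIso_inv_comp]
  -- The two sides differ in the position of `G.mapComp` of `g` and `h` relative to `unitIso f`.
  rw [reassoc_of% whiskerRight_assoc_whiskerLeft]
  simp

/-- The functors `h ↦ u X ≫ G h` are pseudo natural in `X`, with coherence 2-cells `precompIso`. -/
noncomputable def arrowNatLeft (A : 𝒜) :
    PseudoNaturality ((opPseudofunctor (leftBiadjoint hu)).comp (yoneda₀ A)) (yoneda₀ (G.obj A))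
      (fun X => (arrowFunctor G (u X.unop) A).toCatHom) where
  naturality {Y X} f := Cat.Hom.isoMk
    (F := precomp A (liftMap hu f.unop) ⋙ arrowFunctor G (u X.unop) A)
    (G := arrowFunctor G (u Y.unop) A ⋙ precomp (G.obj A) f.unop) <|
    NatIso.ofComponents (precompIso hu f.unop) (precompIso_naturality_right hu f.unop)
  naturality_naturality β := by
    ext h
    exact precompIso_naturality_left hu β.unop2 h
  naturality_id X := by
    have key : ∀ h : r X.unop ⟶ A,
        (precompIso hu (𝟙 X.unop) h).hom ≫ (λ_ (u X.unop ≫ G.map h)).hom =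
        u X.unop ◁ G.map₂ ((liftMapId hu X.unop).hom ▷ h ≫ (λ_ h).hom) ≫ 𝟙 _ ≫ 𝟙 _ := by
      intro h; rw [precompIso_id]; simp
    ext h
    exact key h
  naturality_comp {Z Y X} g f := by
    have key : ∀ h : r Z.unop ⟶ A,
        (precompIso hu (f.unop ≫ g.unop) h).hom ≫ (α_ f.unop g.unop (u Z.unop ≫ G.map h)).hom =
        u X.unop ◁ G.map₂ ((liftMapComp hu f.unop g.unop).hom ▷ h ≫ (α_ _ _ _).hom) ≫ 𝟙 _ ≫
        (precompIso hu f.unop (liftMap hu g.unop ≫ h)).hom ≫ 𝟙 _ ≫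
          f.unop ◁ (precompIso hu g.unop h).hom ≫ 𝟙 _ := by
      intro h; rw [precompIso_comp]; simp
    ext h
    exact key h

/-- The biadjunction with hom functors `f ↦ u X ≫ G f`. -/
noncomputable def arrowBiadjunction : Biadjunction (leftBiadjoint hu) G
    (fun X A => arrowFunctor G (R := (leftBiadjoint hu).obj X) ((unit hu).app X) A) where
  isEquivalence X A := hu X A
  natLeft := arrowNatLeft hu
  natRight X := arrowNatRight G (u X)

end PseudoNaturality

/-! ### Biuniversal arrows from a biadjunction -/

section BiadjunctionToBiuniversal

variable {𝒳 : Type u₁} [Bicategory.{w, v} 𝒳] {𝒜 : Type u₂} [Bicategory.{w, v} 𝒜]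

/-- The image of an identity 1-cell under a biadjunction is a biuniversal arrow. -/
theorem Biadjunction.isBiuniversal {F : 𝒳 ⥤ᵖ 𝒜} {G : 𝒜 ⥤ᵖ 𝒳}
    {φ : ∀ (X : 𝒳) (A : 𝒜), (F.obj X ⟶ A) ⥤ (X ⟶ G.obj A)} (b : Biadjunction F G φ) (X : 𝒳) :
    IsBiuniversal G ((φ X (F.obj X)).obj (𝟙 (F.obj X))) := by
  intro A
  have := b.isEquivalence X A
  -- The coherence cell at `f`, evaluated at the identity, compares `φ X A` with `arrowFunctor`.
  let e (f : F.obj X ⟶ A) : (φ X A).obj (𝟙 _ ≫ f) ≅ (φ X (F.obj X)).obj (𝟙 (F.obj X)) ≫ G.map f :=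
    (Cat.Hom.toNatIso ((b.natRight X).naturality f)).app (𝟙 (F.obj X))
  have he {f g : F.obj X ⟶ A} (γ : f ⟶ g) : (φ X A).map (𝟙 _ ◁ γ) ≫ (e g).hom =
      (e f).hom ≫ (φ X (F.obj X)).obj (𝟙 (F.obj X)) ◁ G.map₂ γ :=
    congrArg (fun t => t.toNatTrans.app (𝟙 (F.obj X))) ((b.natRight X).naturality_naturality γ)
  refine Functor.isEquivalence_of_iso (F := φ X A) (NatIso.ofComponents
    (fun f => (φ X A).mapIso (λ_ f).symm ≪≫ e f) fun {f g} γ => ?_)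
  have h : γ ≫ (λ_ g).inv = (λ_ f).inv ≫ 𝟙 _ ◁ γ := by simp
  change (φ X A).map γ ≫ (φ X A).map (λ_ g).inv ≫ (e g).hom =
    ((φ X A).map (λ_ f).inv ≫ (e f).hom) ≫ (φ X (F.obj X)).obj (𝟙 (F.obj X)) ◁ G.map₂ γ
  rw [Category.assoc, ← he, ← Functor.map_comp_assoc, ← Functor.map_comp_assoc, h]

end BiadjunctionToBiuniversal

end Biadj

theorem mainTheorem4 {𝒳 : Type u₁} [Bicategory.{w, v} 𝒳] [Bicategory.Strict 𝒳]
    {𝒜 : Type u₂} [Bicategory.{w, v} 𝒜] [Bicategory.Strict 𝒜] (G : 𝒜 ⥤ᵖ 𝒳) :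
    ((∃ F : 𝒳 ⥤ᵖ 𝒜, Biadj.IsLeftBiadjoint F G) ↔
      ∀ X : 𝒳, ∃ (R : 𝒜) (u : X ⟶ G.obj R), Biadj.IsBiuniversal G u) ∧
    (∀ u : ∀ X : 𝒳, Σ R : 𝒜, (X ⟶ G.obj R), (∀ X : 𝒳, Biadj.IsBiuniversal G (u X).2) →
      ∃ (F : 𝒳 ⥤ᵖ 𝒜) (η : Pseudofunctor.StrongTrans (Pseudofunctor.id 𝒳) (F.comp G)),
        (∀ X : 𝒳, (⟨F.obj X, η.app X⟩ : Σ R : 𝒜, (X ⟶ G.obj R)) = u X) ∧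
        ∃ b : Biadj.Biadjunction F G (fun X A => Biadj.arrowFunctor G (R := F.obj X) (η.app X) A),
          (∀ (X : 𝒳) {A A' : 𝒜} (k : A ⟶ A') (e : F.obj X ⟶ A),
            ((b.natRight X).naturality k).inv.toNatTrans.app e =
              (α_ (η.app X) (G.map e) (G.map k)).hom ≫ η.app X ◁ (G.mapComp e k).inv) ∧
          (∀ (A : 𝒜) {X Y : 𝒳} (f : X ⟶ Y) (h : F.obj Y ⟶ A),
            ((b.natLeft A).naturality f.op).inv.toNatTrans.app h =
              (α_ f (η.app Y) (G.map h)).inv ≫ (η.naturality f).hom ▷ G.map h ≫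
                (α_ (η.app X) (G.map (F.map f)) (G.map h)).hom ≫
                  η.app X ◁ (G.mapComp (F.map f) h).inv)) := by
  refine ⟨⟨fun ⟨F, φ, ⟨b⟩⟩ X => ⟨F.obj X, _, b.isBiuniversal X⟩, fun h => ?_⟩, fun u hu => ?_⟩
  · choose R u hu using h
    exact ⟨Biadj.leftBiadjoint hu, _, ⟨Biadj.arrowBiadjunction hu⟩⟩
  · refine ⟨Biadj.leftBiadjoint hu, Biadj.unit hu, fun X => rfl,
      Biadj.arrowBiadjunction hu, fun X A A' k e => rfl, fun A X Y f h => ?_⟩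
    -- The inverse of `precompIso` is the required cell, bracketed to the left.
    exact (Category.assoc _ _ _).trans (Category.assoc _ _ _)
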